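/- For $n\ge 1$ let $B_n=\{x\in\mathbb R^n:\|x\|\le 1\}$ be the closed Euclidean unit ball, and let $C(B_n)$ be the space of continuous functions $f:B_n\to\mathbb R$ with the uniform norm. Given points $x^{(1)},\dots,x^{(n+1)}\in B_n$ that are the vertices of a nondegenerate $n$-dimensional simplex, the corresponding interpolation projector is the linear operator $P$ that sends $f\in C(B_n)$ to the unique polynomial $Pf$ in $n$ variables of degree at most $1$ with $Pf(x^{(j)})=f(x^{(j)})$ for $1\le j\le n+1$; $\|P\|_{B_n}$ denotes its norm as an operator from $C(B_n)$ to $C(B_n)$. Let $\theta_n(B_n)$ be the minimal value (infimum) of $\|P\|_{B_n}$ over all such choices of nodes in $B_n$. Theorem 11.4. There is a constant $c>0$ not depending on $n$ such that $$\theta_n(B_n)>c\sqrt n\qquad\text{for all } n\ge 1.$$ This inequality holds for all $n\ge1$, for example, with $$c=\frac{\sqrt[3]{\pi}}{\sqrt{12e}\cdot\sqrt[6]{3}}=0.2135\ldots$$ Moreover, $\theta_n(B_n)\asymp\sqrt n$, that is, there are constants $c_1,c_2>0$ not depending on $n$ such that $c_1\sqrt n\le\theta_n(B_n)\le c_2\sqrt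 n$ for all $n\ge1$. -/

import Mathlib

/-- The closed unit ball `B_n` of `n`-dimensional Euclidean space, centred at the origin. -/
abbrev unitBall (n : ℕ) : Set (EuclideanSpace ℝ (Fin n)) :=
  Metric.closedBall (0 : EuclideanSpace ℝ (Fin n)) 1

/-- `P : C(Ω) → C(Ω)` is the linear interpolation projector with nodes `x 0, …, x n` in `Ω`:
the nodes are the vertices of a nondegenerate `n`-dimensional simplex, every `P f` is (the
restriction to `Ω` of) a polynomial of degree at most one in `n` variables, i.e. of an affine
function on `ℝⁿ`, and `P f` agrees with `f` at all the nodes. -/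
structure IsInterpolationProjector {n : ℕ} (Ω : Set (EuclideanSpace ℝ (Fin n))) [CompactSpace Ω]
    (x : Fin (n + 1) → Ω) (P : C(Ω, ℝ) →L[ℝ] C(Ω, ℝ)) : Prop where
  nondegenerate : AffineIndependent ℝ (fun j => (x j : EuclideanSpace ℝ (Fin n)))
  degree_le_one : ∀ f : C(Ω, ℝ), ∃ g : EuclideanSpace ℝ (Fin n) →ᵃ[ℝ] ℝ, ∀ y : Ω, P f y = g y
  interpolates : ∀ (f : C(Ω, ℝ)) (j : Fin (n + 1)), P f (x j) = f (x j)

/-- `θ_n(Ω)`: the minimal norm, as an operator on `C(Ω)` with the uniform norm, of a linear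
interpolation projector with nodes in `Ω`. -/
noncomputable def interpTheta {n : ℕ} (Ω : Set (EuclideanSpace ℝ (Fin n))) [CompactSpace Ω] : ℝ :=
  sInf {r : ℝ | ∃ (x : Fin (n + 1) → Ω) (P : C(Ω, ℝ) →L[ℝ] C(Ω, ℝ)),
    IsInterpolationProjector Ω x P ∧ r = ‖P‖}

/-! Let `a j` be the gradients of the barycentric coordinates of the nodes `x j`. If `f` takes
values `ε j` in `[-1, 1]` at the nodes and `‖f‖ ≤ 1`, then `P f` has gradient `∑ ε j • a j` and is
bounded by `‖P‖` on the ball, so this gradient has length at most `‖P‖`. A good choice of signs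
gives `∑ ‖a j‖² ≤ ‖P‖²`. The trace identity `∑ ⟪a j, x j⟫ = n` and `‖x j‖ ≤ 1` force `∑ ‖a j‖ ≥ n`,
so Cauchy–Schwarz yields `n² ≤ (n + 1) ‖P‖²`. Hence every constant below `1/2` is admissible, in
particular the stated `0.2135…`. For the upper bound, the simplex on the origin and the standard
basis already has a projector of norm at most `1 + 2√n ≤ 3√n`. -/

open Metric

/-- Signs can be chosen so that a signed sum of vectors has at least the length it would have
if the vectors were pairwise orthogonal. -/
lemma exists_signs_sum_sq_norm_le {E ι : Type*} [NormedAddCommGroup E] [InnerProductSpace ℝ E]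
    (s : Finset ι) (a : ι → E) :
    ∃ ε : ι → ℝ, (∀ j, |ε j| ≤ 1) ∧ ∑ j ∈ s, ‖a j‖ ^ 2 ≤ ‖∑ j ∈ s, ε j • a j‖ ^ 2 := by
  classical
  induction s using Finset.induction_on with
  | empty => exact ⟨fun _ => 0, by simp, by simp⟩
  | insert i s hi ih =>
    obtain ⟨ε, hε, h⟩ := ih
    have key : ∀ σ : ℝ, ∑ j ∈ insert i s, Function.update ε i σ j • a j
        = σ • a i + ∑ j ∈ s, ε j • a j := by
      intro σ
      rw [Finset.sum_insert hi, Function.update_self]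
      congr 1
      refine Finset.sum_congr rfl fun j hj => ?_
      rw [Function.update_of_ne (by rintro rfl; exact hi hj)]
    have bound : ∀ σ : ℝ, |σ| ≤ 1 → ∀ j, |Function.update ε i σ j| ≤ 1 := by
      intro σ hσ j
      by_cases hj : j = i
      · subst hj; simpa using hσ
      · simpa [Function.update_of_ne hj] using hε j
    rw [Finset.sum_insert hi]
    -- The new sign makes the cross term in the squared norm nonnegative.
    rcases le_total 0 (inner ℝ (a i) (∑ j ∈ s, ε j • a j)) with h0 | h0
    · refine ⟨Function.update ε i 1, bound 1 (by simp), ?_⟩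
      rw [key, one_smul, norm_add_sq_real]
      linarith
    · refine ⟨Function.update ε i (-1), bound (-1) (by simp), ?_⟩
      rw [key, neg_one_smul, norm_add_sq_real, inner_neg_left, norm_neg]
      linarith

/-- A linear form on a finite-dimensional inner product space is an inner product. -/
lemma LinearMap.exists_inner_eq {E : Type*} [NormedAddCommGroup E] [InnerProductSpace ℝ E]
    [FiniteDimensional ℝ E] (l : E →ₗ[ℝ] ℝ) : ∃ a : E, ∀ v, l v = inner ℝ a v := by
  have := FiniteDimensional.complete ℝ E
  refine ⟨(InnerProductSpace.toDual ℝ E).symm l.toContinuousLinearMap, fun v => ?_⟩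
  rw [InnerProductSpace.toDual_symm_apply]
  rfl

/-- The gradient of an affine function bounded by `M` on the unit ball has norm at most `M`. -/
lemma norm_gradient_le_of_abs_le {E : Type*} [NormedAddCommGroup E] [InnerProductSpace ℝ E]
    (g : E →ᵃ[ℝ] ℝ) (a : E) (ha : ∀ v, g.linear v = inner ℝ a v) {M : ℝ}
    (hM : ∀ y ∈ closedBall (0 : E) 1, |g y| ≤ M) : ‖a‖ ≤ M := by
  rcases eq_or_ne a 0 with rfl | h0
  · simpa using (abs_nonneg _).trans (hM 0 (by simp))
  have hn : ‖a‖ ≠ 0 := norm_ne_zero_iff.2 h0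
  set u : E := ‖a‖⁻¹ • a
  have hu : ‖u‖ = 1 := by rw [norm_smul, norm_inv, norm_norm, inv_mul_cancel₀ hn]
  have hau : inner ℝ a u = ‖a‖ := by
    rw [real_inner_smul_right, real_inner_self_eq_norm_sq]; field_simp
  have e : ∀ v, g v = inner ℝ a v + g 0 := fun v => by
    rw [← ha, congrFun g.decomp v]; simp
  have h1 := abs_le.1 (hM u (by simp [hu]))
  have h2 := abs_le.1 (hM (-u) (by simp [hu]))
  -- Subtracting the values at `u` and `-u` cancels the constant term `g 0`.
  rw [e u, hau] at h1
  rw [e (-u), inner_neg_right, hau] at h2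
  linarith [h1.2, h2.1]

/-- An affine function is determined by its values on an affine basis. -/
lemma AffineBasis.linear_eq_sum_coord {ι V : Type*} [Fintype ι] [AddCommGroup V] [Module ℝ V]
    (b : AffineBasis ι ℝ V) (g : V →ᵃ[ℝ] ℝ) (v : V) :
    g.linear v = ∑ j, g (b j) * (b.coord j).linear v := by
  have h : ∀ p, g p = ∑ j, b.coord j p * g (b j) := fun p => by
    conv_lhs => rw [← b.affineCombination_coord_eq_self p]
    rw [Finset.map_affineCombination _ _ _ (b.sum_coord_apply_eq_one p),
      Finset.affineCombination_eq_linear_combination _ _ _ (b.sum_coord_apply_eq_one p)]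
    simp
  have hl : ∀ f : V →ᵃ[ℝ] ℝ, f.linear v = f v - f 0 := fun f => by
    rw [congrFun f.decomp v]; simp
  rw [hl, h v, h 0, ← Finset.sum_sub_distrib]
  exact Finset.sum_congr rfl fun j _ => by rw [hl]; ring

/-- Trace identity for the gradients of the barycentric coordinates. -/
lemma AffineBasis.sum_inner_gradient_eq {ι : Type*} [Fintype ι] {n : ℕ}
    (b : AffineBasis ι ℝ (EuclideanSpace ℝ (Fin n))) (a : ι → EuclideanSpace ℝ (Fin n))
    (ha : ∀ j v, (b.coord j).linear v = inner ℝ (a j) v) :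
    ∑ j, inner ℝ (a j) (b j) = n := by
  have h : ∀ i : Fin n, ∑ j, b j i * a j i = 1 := by
    intro i
    -- Diagonal entry `i` of the identity matrix, written as `∑ j, b j ⊗ a j`.
    have := b.linear_eq_sum_coord (EuclideanSpace.projₗ i).toAffineMap
      (EuclideanSpace.single i (1 : ℝ))
    simp only [ha] at this
    simpa [EuclideanSpace.inner_single_right] using this.symm
  calc ∑ j, inner ℝ (a j) (b j) = ∑ j, ∑ i, b j i * a j i := by
        simp [PiLp.inner_apply]
    _ = ∑ i : Fin n, ∑ j, b j i * a j i := Finset.sum_comm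
    _ = n := by simp [h]

/-- Tietze extension from a finite, hence closed and discrete, set of nodes. -/
lemma exists_continuousMap_eq_of_abs_le {X ι : Type*} [TopologicalSpace X] [CompactSpace X]
    [T2Space X] [Finite ι] {x : ι → X} (hx : Function.Injective x) (ε : ι → ℝ)
    (hε : ∀ j, |ε j| ≤ 1) : ∃ f : C(X, ℝ), ‖f‖ ≤ 1 ∧ ∀ j, f (x j) = ε j := by
  let _ : TopologicalSpace ι := ⊥
  have : DiscreteTopology ι := ⟨rfl⟩
  have he : Topology.IsClosedEmbedding x :=
    continuous_of_discreteTopology.isClosedEmbedding hx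
  let f₀ : BoundedContinuousFunction ι ℝ :=
    BoundedContinuousFunction.mkOfCompact ⟨ε, continuous_of_discreteTopology⟩
  obtain ⟨g, hg, hgx⟩ :=
    BoundedContinuousFunction.exists_extension_norm_eq_of_isClosedEmbedding f₀ he
  refine ⟨g.toContinuousMap, ?_, fun j => congrFun hgx j⟩
  refine (ContinuousMap.norm_le _ zero_le_one).2 fun y => (g.norm_coe_le_norm y).trans ?_
  rw [hg]
  exact (BoundedContinuousFunction.norm_le zero_le_one).2 hε

/-- Every interpolation projector on the unit ball has norm at least `n / √(n + 1)`. -/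
lemma IsInterpolationProjector.sq_le_mul_sq_norm {n : ℕ} {x : Fin (n + 1) → unitBall n}
    {P : C(unitBall n, ℝ) →L[ℝ] C(unitBall n, ℝ)}
    (h : IsInterpolationProjector (unitBall n) x P) :
    (n : ℝ) ^ 2 ≤ (n + 1) * ‖P‖ ^ 2 := by
  let b : AffineBasis (Fin (n + 1)) ℝ (EuclideanSpace ℝ (Fin n)) :=
    ⟨fun j => x j, h.nondegenerate,
      h.nondegenerate.affineSpan_eq_top_iff_card_eq_finrank_add_one.2 (by simp)⟩
  choose a ha using fun j => (b.coord j).linear.exists_inner_eq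
  have htr := b.sum_inner_gradient_eq a ha
  have hsum : (n : ℝ) ≤ ∑ j, ‖a j‖ := by
    rw [← htr]
    refine Finset.sum_le_sum fun j _ => (real_inner_le_norm _ _).trans ?_
    exact mul_le_of_le_one_right (norm_nonneg _) (mem_closedBall_zero_iff.1 (x j).2)
  obtain ⟨ε, hε, hεa⟩ := exists_signs_sum_sq_norm_le Finset.univ a
  obtain ⟨f, hf, hfx⟩ := exists_continuousMap_eq_of_abs_le
    (Function.Injective.of_comp (f := Subtype.val) h.nondegenerate.injective) ε hε
  obtain ⟨g, hg⟩ := h.degree_le_one f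
  have hgb : ∀ j, g (b j) = ε j := fun j => by
    rw [← hfx j, ← h.interpolates f j]; exact (hg (x j)).symm
  have hM : ‖∑ j, ε j • a j‖ ≤ ‖P‖ := by
    refine norm_gradient_le_of_abs_le g _ (fun v => ?_) fun y hy => ?_
    · rw [b.linear_eq_sum_coord, sum_inner]
      exact Finset.sum_congr rfl fun j _ => by rw [hgb, ha, real_inner_smul_left]
    · rw [← hg ⟨y, hy⟩, ← Real.norm_eq_abs]
      exact ((P f).norm_coe_le_norm _).trans
        ((P.le_opNorm f).trans (mul_le_of_le_one_right (norm_nonneg _) hf))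
  have hcs : (∑ j, ‖a j‖) ^ 2 ≤ (n + 1) * ∑ j, ‖a j‖ ^ 2 := by
    simpa using sq_sum_le_card_mul_sum_sq (s := Finset.univ) (f := fun j => ‖a j‖)
  calc (n : ℝ) ^ 2 ≤ (∑ j, ‖a j‖) ^ 2 := by gcongr
    _ ≤ (n + 1) * ∑ j, ‖a j‖ ^ 2 := hcs
    _ ≤ (n + 1) * ‖∑ j, ε j • a j‖ ^ 2 := by gcongr
    _ ≤ (n + 1) * ‖P‖ ^ 2 := by gcongr

lemma IsInterpolationProjector.half_sqrt_le_norm {n : ℕ} (hn : 1 ≤ n)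
    {x : Fin (n + 1) → unitBall n} {P : C(unitBall n, ℝ) →L[ℝ] C(unitBall n, ℝ)}
    (h : IsInterpolationProjector (unitBall n) x P) : 1 / 2 * √(n : ℝ) ≤ ‖P‖ := by
  have h1 := h.sq_le_mul_sq_norm
  have hn' : (1 : ℝ) ≤ n := by exact_mod_cast hn
  refine (abs_le_of_sq_le_sq' ?_ (norm_nonneg P)).2
  rw [mul_pow, Real.sq_sqrt (by positivity)]
  -- Since `n + 1 ≤ 2 * n`, even `n / 2 ≤ ‖P‖ ^ 2` holds; `1 / 2` is a convenient weaker constant.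
  nlinarith [sq_nonneg ‖P‖]

/-- The vertices of the corner simplex: the origin and the standard basis vectors. -/
noncomputable def cornerNodes (n : ℕ) : Fin (n + 1) → unitBall n :=
  Fin.cons ⟨0, by simp⟩ fun i => ⟨EuclideanSpace.single i 1, by simp⟩

lemma affineIndependent_cornerNodes (n : ℕ) :
    AffineIndependent ℝ fun j => (cornerNodes n j : EuclideanSpace ℝ (Fin n)) := by
  rw [affineIndependent_iff_of_fintype]
  intro w hw h
  rw [Finset.weightedVSub_eq_linear_combination (hw := hw), Fin.sum_univ_succ] at h
  -- Coordinate `i` isolates one weight; the weight at the origin then vanishes because the weights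
  -- sum to zero.
  have hs : ∀ i : Fin n, w i.succ = 0 := fun i => by
    have := congrArg (fun v : EuclideanSpace ℝ (Fin n) => v i) h
    simpa [cornerNodes, Pi.single_apply] using this
  intro j
  refine Fin.cases ?_ hs j
  simpa [Fin.sum_univ_succ, hs] using hw

lemma sum_abs_le_sqrt_of_mem_unitBall {n : ℕ} (y : unitBall n) :
    ∑ i, |(y : EuclideanSpace ℝ (Fin n)) i| ≤ √(n : ℝ) := by
  have hy : ∑ i, |(y : EuclideanSpace ℝ (Fin n)) i| ^ 2 ≤ 1 := by
    have h1 : ‖(y : EuclideanSpace ℝ (Fin n))‖ ≤ 1 := mem_closedBall_zero_iff.1 y.2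
    have h2 := EuclideanSpace.norm_sq_eq (y : EuclideanSpace ℝ (Fin n))
    simp only [Real.norm_eq_abs] at h2
    rw [← h2]
    exact pow_le_one₀ (norm_nonneg _) h1
  refine Real.le_sqrt_of_sq_le ?_
  have := sq_sum_le_card_mul_sum_sq (s := Finset.univ)
    (f := fun i => |(y : EuclideanSpace ℝ (Fin n)) i|)
  simp only [Finset.card_univ, Fintype.card_fin] at this
  nlinarith [(Nat.cast_nonneg n : (0 : ℝ) ≤ n)]

/-- Affine interpolation at the vertices of the corner simplex. -/
noncomputable def cornerProjector (n : ℕ) : C(unitBall n, ℝ) →L[ℝ] C(unitBall n, ℝ) :=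
  LinearMap.mkContinuous
    { toFun := fun f => ⟨fun y => f (cornerNodes n 0) +
        ∑ i, (y : EuclideanSpace ℝ (Fin n)) i *
          (f (cornerNodes n i.succ) - f (cornerNodes n 0)), by fun_prop⟩
      map_add' := fun f g => by
        ext y
        simp only [ContinuousMap.coe_mk, ContinuousMap.add_apply]
        rw [add_add_add_comm, ← Finset.sum_add_distrib]
        congr 1
        exact Finset.sum_congr rfl fun i _ => by ring
      map_smul' := fun c f => by
        ext y
        simp only [ContinuousMap.coe_mk, ContinuousMap.smul_apply, smul_eq_mul, RingHom.id_apply]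
        rw [mul_add, Finset.mul_sum]
        congr 1
        exact Finset.sum_congr rfl fun i _ => by ring }
    (1 + 2 * √(n : ℝ)) fun f => by
      refine (ContinuousMap.norm_le _ (by positivity)).2 fun y => ?_
      have hf : ∀ z, |f z| ≤ ‖f‖ := fun z => f.norm_coe_le_norm z
      have hs : |∑ i, (y : EuclideanSpace ℝ (Fin n)) i *
          (f (cornerNodes n i.succ) - f (cornerNodes n 0))| ≤ √(n : ℝ) * (2 * ‖f‖) := by
        calc _ ≤ ∑ i, |(y : EuclideanSpace ℝ (Fin n)) i| * (2 * ‖f‖) := by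
              refine (Finset.abs_sum_le_sum_abs _ _).trans (Finset.sum_le_sum fun i _ => ?_)
              rw [abs_mul]
              gcongr
              linarith [abs_sub (f (cornerNodes n i.succ)) (f (cornerNodes n 0)),
                hf (cornerNodes n i.succ), hf (cornerNodes n 0)]
          _ = (∑ i, |(y : EuclideanSpace ℝ (Fin n)) i|) * (2 * ‖f‖) := by
              rw [Finset.sum_mul]
          _ ≤ √(n : ℝ) * (2 * ‖f‖) := by
              gcongr
              exact sum_abs_le_sqrt_of_mem_unitBall y
      refine (abs_add_le _ _).trans ?_
      linarith [hf (cornerNodes n 0)]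

lemma norm_cornerProjector_le (n : ℕ) : ‖cornerProjector n‖ ≤ 1 + 2 * √(n : ℝ) :=
  LinearMap.mkContinuous_norm_le _ (by positivity) _

lemma cornerProjector_apply {n : ℕ} (f : C(unitBall n, ℝ)) (y : unitBall n) :
    cornerProjector n f y = f (cornerNodes n 0) +
      ∑ i, (y : EuclideanSpace ℝ (Fin n)) i *
        (f (cornerNodes n i.succ) - f (cornerNodes n 0)) := rfl

lemma isInterpolationProjector_cornerProjector (n : ℕ) :
    IsInterpolationProjector (unitBall n) (cornerNodes n) (cornerProjector n) where
  nondegenerate := affineIndependent_cornerNodes n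
  degree_le_one f := by
    refine ⟨AffineMap.const ℝ _ (f (cornerNodes n 0)) +
      (∑ i, (f (cornerNodes n i.succ) - f (cornerNodes n 0)) •
        (EuclideanSpace.projₗ i : EuclideanSpace ℝ (Fin n) →ₗ[ℝ] ℝ)).toAffineMap, fun y => ?_⟩
    simp [cornerProjector_apply, mul_comm]
  interpolates f j := by
    rw [cornerProjector_apply]
    refine Fin.cases ?_ (fun i => ?_) j
    · simp [cornerNodes]
    · simp [cornerNodes]

lemma half_sqrt_le_interpTheta {n : ℕ} (hn : 1 ≤ n) :
    1 / 2 * √(n : ℝ) ≤ interpTheta (unitBall n) := by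
  -- A projector must exist here: the real `sInf` of the empty set is `0`.
  refine le_csInf ⟨_, _, _, isInterpolationProjector_cornerProjector n, rfl⟩ ?_
  rintro _ ⟨x, P, h, rfl⟩
  exact h.half_sqrt_le_norm hn

lemma interpTheta_le {n : ℕ} (hn : 1 ≤ n) : interpTheta (unitBall n) ≤ 3 * √(n : ℝ) := by
  have h1 : interpTheta (unitBall n) ≤ ‖cornerProjector n‖ := by
    refine csInf_le ⟨0, ?_⟩ ⟨_, _, isInterpolationProjector_cornerProjector n, rfl⟩
    rintro _ ⟨x, P, -, rfl⟩
    exact norm_nonneg P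
  have h2 : 1 ≤ √(n : ℝ) := Real.one_le_sqrt.2 (by exact_mod_cast hn)
  linarith [norm_cornerProjector_le n]

/-- The sixth power clears every root, with `5184 = 12 ^ 3 * 3`, so numerical bounds on `π` and `e`
suffice. -/
lemma pow_six_interpConst :
    (Real.pi ^ (1 / 3 : ℝ) / (√(12 * Real.exp 1) * (3 : ℝ) ^ (1 / 6 : ℝ))) ^ 6
      = Real.pi ^ 2 / (5184 * Real.exp 1 ^ 3) := by
  have h1 : (Real.pi ^ (1 / 3 : ℝ)) ^ 6 = Real.pi ^ 2 := by
    rw [← Real.rpow_natCast, ← Real.rpow_mul Real.pi_pos.le, ← Real.rpow_natCast]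
    norm_num
  have h2 : ((3 : ℝ) ^ (1 / 6 : ℝ)) ^ 6 = 3 := by
    rw [← Real.rpow_natCast, ← Real.rpow_mul (by norm_num)]
    norm_num
  have h3 : √(12 * Real.exp 1) ^ 6 = (12 * Real.exp 1) ^ 3 := by
    rw [show 6 = 2 * 3 from rfl, pow_mul, Real.sq_sqrt (by positivity)]
  rw [div_pow, mul_pow, h1, h2, h3]
  ring

lemma interpConst_bounds :
    (0.2135 : ℝ) ≤ Real.pi ^ (1 / 3 : ℝ) / (√(12 * Real.exp 1) * (3 : ℝ) ^ (1 / 6 : ℝ)) ∧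
      Real.pi ^ (1 / 3 : ℝ) / (√(12 * Real.exp 1) * (3 : ℝ) ^ (1 / 6 : ℝ)) < 0.2136 := by
  have hpos : 0 ≤ Real.pi ^ (1 / 3 : ℝ) / (√(12 * Real.exp 1) * (3 : ℝ) ^ (1 / 6 : ℝ)) := by
    positivity
  have hπ₁ : (3.1415 : ℝ) ^ 2 ≤ Real.pi ^ 2 := by gcongr; exact Real.pi_gt_d4.le
  have hπ₂ : Real.pi ^ 2 ≤ (3.1416 : ℝ) ^ 2 := by gcongr; exact Real.pi_lt_d4.le
  have he₁ : (2.7182 : ℝ) ^ 3 ≤ Real.exp 1 ^ 3 := by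
    gcongr; linarith [Real.exp_one_gt_d9]
  have he₂ : Real.exp 1 ^ 3 ≤ (2.7183 : ℝ) ^ 3 := by
    gcongr; linarith [Real.exp_one_lt_d9]
  constructor
  · refine le_of_pow_le_pow_left₀ (n := 6) (by norm_num) hpos ?_
    rw [pow_six_interpConst, le_div_iff₀ (by positivity)]
    norm_num at *
    linarith
  · refine lt_of_pow_lt_pow_left₀ 6 (by norm_num) ?_
    rw [pow_six_interpConst, div_lt_iff₀ (by positivity)]
    norm_num at *
    linarith

theorem theorem11p4 :
    -- existence of an absolute constant in the lower bound
    (∃ c : ℝ, 0 < c ∧ ∀ n : ℕ, 1 ≤ n → c * √(n : ℝ) < interpTheta (unitBall n)) ∧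
    -- an explicit admissible constant and its decimal value
    (∀ n : ℕ, 1 ≤ n →
      Real.pi ^ (1 / 3 : ℝ) / (√(12 * Real.exp 1) * (3 : ℝ) ^ (1 / 6 : ℝ)) * √(n : ℝ)
        < interpTheta (unitBall n)) ∧
    ((0.2135 : ℝ) ≤ Real.pi ^ (1 / 3 : ℝ) / (√(12 * Real.exp 1) * (3 : ℝ) ^ (1 / 6 : ℝ)) ∧
      Real.pi ^ (1 / 3 : ℝ) / (√(12 * Real.exp 1) * (3 : ℝ) ^ (1 / 6 : ℝ)) < 0.2136) ∧
    -- the exact order of growth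
    (∃ c₁ c₂ : ℝ, 0 < c₁ ∧ 0 < c₂ ∧ ∀ n : ℕ, 1 ≤ n →
      c₁ * √(n : ℝ) ≤ interpTheta (unitBall n) ∧
      interpTheta (unitBall n) ≤ c₂ * √(n : ℝ)) := by
  have hlt : ∀ c : ℝ, c < 1 / 2 → ∀ n : ℕ, 1 ≤ n → c * √(n : ℝ) < interpTheta (unitBall n) := by
    intro c hc n hn
    have hs : 0 < √(n : ℝ) := Real.sqrt_pos.2 (by exact_mod_cast hn)
    exact (mul_lt_mul_of_pos_right hc hs).trans_le (half_sqrt_le_interpTheta hn)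
  refine ⟨⟨1 / 4, by norm_num, hlt _ (by norm_num)⟩,
    hlt _ (interpConst_bounds.2.trans (by norm_num)), interpConst_bounds,
    ⟨1 / 2, 3, by norm_num, by norm_num, fun n hn =>
      ⟨half_sqrt_le_interpTheta hn, interpTheta_le hn⟩⟩⟩
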